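/- Formulas of the Lambek calculus are built from a set of variables by the binary connectives $\backslash$, $/$, $\bullet$. A sequent $\Gamma\vdash\varphi$ consists of a nonempty finite sequence $\Gamma$ of formulas and a formula $\varphi$. A sequent is derivable if it can be obtained from the axioms $\varphi\vdash\varphi$ by the (cut-free) rules $$\frac{\Gamma\vdash\varphi\quad \Delta,\psi,\Theta\vdash\theta}{\Delta,\Gamma,\varphi\backslash\psi,\Theta\vdash\theta},\quad \frac{\varphi,\Pi\vdash\psi}{\Pi\vdash\varphi\backslash\psi},\quad \frac{\Gamma\vdash\varphi\quad \Delta,\psi,\Theta\vdash\theta}{\Delta,\psi/\varphi,\Gamma,\Theta\vdash\theta},\quad \frac{\Pi,\varphi\vdash\psi}{\Pi\vdash\psi/\varphi},$$ $$\frac{\Gamma,\varphi,\psi,\Delta\vdash\theta}{\Gamma,\varphi\bullet\psi,\Delta\vdash\theta},\quad \frac{\Gamma\vdash\varphi\quad\Delta\vdash\psi}{\Gamma,\Delta\vdash\varphi\bullet\psi},$$ where $\Gamma$ in the rules with two premises (and $\Delta$ in the last rule), as well as $\Pi$, is nonempty. A relational residuated semigroup on a base set $W$ is a set $A$ of binary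 relations on $W$ such that $R=\bigcup A$ is transitive and has domain $W$ (for each $x\in W$ there is $y$ with $(x,y)\in R$), and such that $A$ is closed under the operations $$a;b=\{(x,z)\mid \exists y\in W\ ((x,y)\in a \text{ and } (y,z)\in b)\},$$ $$a\backslash b=\{(x,y)\in R\mid \forall z\in W\ ((z,x)\in a\Rightarrow (z,y)\in b)\},$$ $$a/b=\{(x,y)\in R\mid \forall z\in W\ ((y,z)\in b\Rightarrow (x,z)\in a)\};$$ it is ordered by inclusion. A finite relational model is such an algebra $A$ on a finite base $W$ together with a map from the variables to $A$. This map extends to all formulas by interpreting $\bullet,\backslash,/$ as $;,\backslash,/$. The sequent $\varphi_1,\dots,\varphi_n\vdash\psi$ is true in the model if $v(\varphi_1);\cdots;v(\varphi_n)\subseteq v(\psi)$, where $v$ denotes the extended map. Theorem. The Lambek calculus is complete with respect to finite relational models (it has the finite model property): a sequent $\Gamma\vdash\varphi$ with $\Gamma$ nonempty is derivable if and only if it is true in every finite relational model. In particular, every non-derivable sequent is false in some relational model with a finite base. -/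

import Mathlib

/-- Formulas of the Lambek calculus over a set `α` of variables. -/
inductive LambekFormula (α : Type*) where
  | var : α → LambekFormula α
  /-- `ldiv φ ψ` is `φ \ ψ`. -/
  | ldiv : LambekFormula α → LambekFormula α → LambekFormula α
  /-- `rdiv φ ψ` is `φ / ψ`. -/
  | rdiv : LambekFormula α → LambekFormula α → LambekFormula α
  /-- `prod φ ψ` is `φ • ψ`. -/
  | prod : LambekFormula α → LambekFormula α → LambekFormula α

/-- Derivability of a sequent `Γ ⊢ φ` in the cut-free sequent calculus of Lambek. Antecedents are
nonempty; it is enough to require this in the two rules that shorten the antecedent. -/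
inductive LambekDerivable {α : Type*} : List (LambekFormula α) → LambekFormula α → Prop where
  | ax (φ : LambekFormula α) : LambekDerivable [φ] φ
  | ldiv_left {Γ Δ Θ : List (LambekFormula α)} {φ ψ θ : LambekFormula α} :
      LambekDerivable Γ φ → LambekDerivable (Δ ++ [ψ] ++ Θ) θ →
      LambekDerivable (Δ ++ Γ ++ [.ldiv φ ψ] ++ Θ) θ
  | ldiv_right {Γ : List (LambekFormula α)} {φ ψ : LambekFormula α} :
      Γ ≠ [] → LambekDerivable ([φ] ++ Γ) ψ → LambekDerivable Γ (.ldiv φ ψ)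
  | rdiv_left {Γ Δ Θ : List (LambekFormula α)} {φ ψ θ : LambekFormula α} :
      LambekDerivable Γ φ → LambekDerivable (Δ ++ [ψ] ++ Θ) θ →
      LambekDerivable (Δ ++ [.rdiv ψ φ] ++ Γ ++ Θ) θ
  | rdiv_right {Γ : List (LambekFormula α)} {φ ψ : LambekFormula α} :
      Γ ≠ [] → LambekDerivable (Γ ++ [φ]) ψ → LambekDerivable Γ (.rdiv ψ φ)
  | prod_left {Γ Δ : List (LambekFormula α)} {φ ψ θ : LambekFormula α} :
      LambekDerivable (Γ ++ [φ, ψ] ++ Δ) θ → LambekDerivable (Γ ++ [.prod φ ψ] ++ Δ) θ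
  | prod_right {Γ Δ : List (LambekFormula α)} {φ ψ : LambekFormula α} :
      LambekDerivable Γ φ → LambekDerivable Δ ψ → LambekDerivable (Γ ++ Δ) (.prod φ ψ)

/-- The left residual `a \ b`, computed inside the relation `R`. -/
def relLdiv {W : Type*} (R a b : SetRel W W) : SetRel W W :=
  {p | p ∈ R ∧ ∀ z : W, (z, p.1) ∈ a → (z, p.2) ∈ b}

/-- The right residual `a / b`, computed inside the relation `R`. -/
def relRdiv {W : Type*} (R a b : SetRel W W) : SetRel W W :=
  {p | p ∈ R ∧ ∀ z : W, (p.2, z) ∈ b → (p.1, z) ∈ a}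

/-- A relational residuated semigroup on the base `W`: a set of binary relations on `W` whose union
`R` is transitive and has domain `W`, and which is closed under composition and under both
residuals computed inside `R`. The order is inclusion. -/
structure RelResiduatedSemigroup (W : Type*) where
  carrier : Set (SetRel W W)
  trans : ∀ x y z : W, (x, y) ∈ ⋃₀ carrier → (y, z) ∈ ⋃₀ carrier → (x, z) ∈ ⋃₀ carrier
  dom_eq : ∀ x : W, ∃ y : W, (x, y) ∈ ⋃₀ carrier
  comp_mem : ∀ a ∈ carrier, ∀ b ∈ carrier, SetRel.comp a b ∈ carrier
  ldiv_mem : ∀ a ∈ carrier, ∀ b ∈ carrier, relLdiv (⋃₀ carrier) a b ∈ carrier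
  rdiv_mem : ∀ a ∈ carrier, ∀ b ∈ carrier, relRdiv (⋃₀ carrier) a b ∈ carrier

namespace RelResiduatedSemigroup

/-- The value of a formula under a valuation of the variables in the algebra. -/
def eval {W α : Type*} (A : RelResiduatedSemigroup W) (v : α → A.carrier) :
    LambekFormula α → SetRel W W
  | .var p => (v p : SetRel W W)
  | .ldiv φ ψ => relLdiv (⋃₀ A.carrier) (A.eval v φ) (A.eval v ψ)
  | .rdiv φ ψ => relRdiv (⋃₀ A.carrier) (A.eval v φ) (A.eval v ψ)
  | .prod φ ψ => SetRel.comp (A.eval v φ) (A.eval v ψ)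

/-- The value of an antecedent: the composition of the values of its members. -/
def evalList {W α : Type*} (A : RelResiduatedSemigroup W) (v : α → A.carrier) :
    List (LambekFormula α) → SetRel W W
  | [] => SetRel.id
  | φ :: Γ => SetRel.comp (A.eval v φ) (A.evalList v Γ)

/-- Truth of the sequent `Γ ⊢ φ` in the relational model `(A, v)`. -/
def Satisfies {W α : Type*} (A : RelResiduatedSemigroup W) (v : α → A.carrier)
    (Γ : List (LambekFormula α)) (φ : LambekFormula α) : Prop :=
  A.evalList v Γ ⊆ A.eval v φ

theorem eval_mem {W α : Type*} (A : RelResiduatedSemigroup W) (v : α → A.carrier)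
    (φ : LambekFormula α) : A.eval v φ ∈ A.carrier := by
  induction φ with
  | var p => exact (v p).2
  | ldiv φ ψ h₁ h₂ => exact A.ldiv_mem _ h₁ _ h₂
  | rdiv φ ψ h₁ h₂ => exact A.rdiv_mem _ h₁ _ h₂
  | prod φ ψ h₁ h₂ => exact A.comp_mem _ h₁ _ h₂

end RelResiduatedSemigroup

/-! Soundness is an induction on derivations. For completeness, a canonical model grows from a
single point: pairs of points are labelled by antecedents, and new points witness residuals and
products of subformulas of the given sequent. To stop this process, each point gets its stage of
creation as depth, and a pair of depth `t` is read through `DerivableOrLarge N t`, where every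
sequent of size above `N - t` counts as derivable. A rule that costs one level of depth also removes
one connective, so the bound is respected; at depth `N` everything counts as derivable, and stage
`N` is enough.

The truth lemma is `mem_eval_and_derivableOrLarge`. As cut is not available, it is not an
equivalence but a pair of implications: a label that can replace `c` in antecedents puts the pair
into the value of `c`, and a pair in that value has a label deriving `c` up to the bound.

The stages are built by `next`, whose main invariant is `split`. Finally `double` gives every point
of stage `N` a reflexive companion of depth `N`; the companions make the relation serial and serve
as midpoints for products where the stage has none. A path from the root spells the antecedent, and
`N` is so large that at its ends "derivable or large" means derivable. -/

namespace LambekFormula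

/-! ### Sizes and subformulas -/

/-- The number of symbols of a formula. -/
def size {α : Type*} : LambekFormula α → ℕ
  | .var _ => 1
  | .ldiv a b => a.size + b.size + 1
  | .rdiv a b => a.size + b.size + 1
  | .prod a b => a.size + b.size + 1

theorem one_le_size {α : Type*} (a : LambekFormula α) : 1 ≤ a.size := by
  cases a <;> simp [size]

/-- The list of subformulas of a formula. -/
def subformulas {α : Type*} : LambekFormula α → List (LambekFormula α)
  | .var p => [.var p]
  | .ldiv a b => .ldiv a b :: (a.subformulas ++ b.subformulas)
  | .rdiv a b => .rdiv a b :: (a.subformulas ++ b.subformulas)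
  | .prod a b => .prod a b :: (a.subformulas ++ b.subformulas)

theorem mem_subformulas_self {α : Type*} (a : LambekFormula α) : a ∈ a.subformulas := by
  cases a <;> simp [subformulas]

theorem mem_subformulas_trans {α : Type*} {a b c : LambekFormula α} (h : a ∈ b.subformulas)
    (h' : b ∈ c.subformulas) : a ∈ c.subformulas := by
  induction c with
  | var p => simp only [subformulas, List.mem_singleton] at h'; rwa [h'] at h
  | ldiv c d hc hd | rdiv c d hc hd | prod c d hc hd =>
    simp only [subformulas, List.mem_cons, List.mem_append] at h'
    rcases h' with rfl | h' | h'
    · exact h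
    · simp [subformulas, hc h']
    · simp [subformulas, hd h']

end LambekFormula

/-- The total size of an antecedent. -/
def antecedentSize {α : Type*} (Γ : List (LambekFormula α)) : ℕ :=
  (Γ.map LambekFormula.size).sum

@[simp] theorem antecedentSize_nil {α : Type*} :
    antecedentSize ([] : List (LambekFormula α)) = 0 := rfl

@[simp] theorem antecedentSize_cons {α : Type*} (a : LambekFormula α)
    (Γ : List (LambekFormula α)) : antecedentSize (a :: Γ) = a.size + antecedentSize Γ := by
  simp [antecedentSize]

@[simp] theorem antecedentSize_append {α : Type*} (Γ Δ : List (LambekFormula α)) :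
    antecedentSize (Γ ++ Δ) = antecedentSize Γ + antecedentSize Δ := by
  simp [antecedentSize]

/-! ### Derivability up to a size bound -/

/-- A sequent that is derivable or has size exceeding `N - t`. -/
def DerivableOrLarge {α : Type*} (N t : ℕ) (Γ : List (LambekFormula α)) (θ : LambekFormula α) :
    Prop :=
  LambekDerivable Γ θ ∨ N < t + antecedentSize Γ + θ.size

namespace DerivableOrLarge

variable {α : Type*} {N t s : ℕ} {Γ Δ Θ : List (LambekFormula α)} {a b θ : LambekFormula α}

theorem mono (h : t ≤ s) : DerivableOrLarge N t Γ θ → DerivableOrLarge N s Γ θ := by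
  rintro (h' | h')
  · exact .inl h'
  · exact .inr (by omega)

theorem of_le (h : N ≤ t) : DerivableOrLarge N t Γ θ :=
  .inr (by have := θ.one_le_size; omega)

theorem ax : DerivableOrLarge N t [a] a := .inl (.ax a)

/-- Each premise of a cut-free rule is smaller than the conclusion, so a large premise forces a
large conclusion at the same depth. -/
theorem ldiv_left (h₁ : DerivableOrLarge N t Γ a) (h₂ : DerivableOrLarge N t (Δ ++ [b] ++ Θ) θ) :
    DerivableOrLarge N t (Δ ++ (Γ ++ [.ldiv a b]) ++ Θ) θ := by
  rcases h₁ with h₁ | h₁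
  · rcases h₂ with h₂ | h₂
    · left; simpa using LambekDerivable.ldiv_left h₁ h₂
    · right; simp [LambekFormula.size] at h₂ ⊢; omega
  · right; simp [LambekFormula.size]; omega

theorem rdiv_left (h₁ : DerivableOrLarge N t Γ a) (h₂ : DerivableOrLarge N t (Δ ++ [b] ++ Θ) θ) :
    DerivableOrLarge N t (Δ ++ ([.rdiv b a] ++ Γ) ++ Θ) θ := by
  rcases h₁ with h₁ | h₁
  · rcases h₂ with h₂ | h₂
    · left; simpa using LambekDerivable.rdiv_left h₁ h₂
    · right; simp [LambekFormula.size] at h₂ ⊢; omega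
  · right; simp [LambekFormula.size]; omega

theorem prod_right (h₁ : DerivableOrLarge N t Γ a) (h₂ : DerivableOrLarge N t Δ b) :
    DerivableOrLarge N t (Γ ++ Δ) (.prod a b) := by
  rcases h₁ with h₁ | h₁
  · rcases h₂ with h₂ | h₂
    · exact .inl (.prod_right h₁ h₂)
    · right; simp [LambekFormula.size]; omega
  · right; simp [LambekFormula.size]; omega

/-- The premise has exactly one symbol less, which pays for its extra unit of depth. The same
balance holds in `rdiv_right` and `prod_left`. -/
theorem ldiv_right (hΓ : Γ ≠ []) (h : DerivableOrLarge N (t + 1) (a :: Γ) b) :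
    DerivableOrLarge N t Γ (.ldiv a b) := by
  rcases h with h | h
  · exact .inl (.ldiv_right hΓ h)
  · right; simp [LambekFormula.size] at h ⊢; omega

theorem rdiv_right (hΓ : Γ ≠ []) (h : DerivableOrLarge N (t + 1) (Γ ++ [a]) b) :
    DerivableOrLarge N t Γ (.rdiv b a) := by
  rcases h with h | h
  · exact .inl (.rdiv_right hΓ h)
  · right; simp [LambekFormula.size] at h ⊢; omega

theorem prod_left (h : DerivableOrLarge N (t + 1) (Γ ++ [a, b] ++ Δ) θ) :
    DerivableOrLarge N t (Γ ++ [.prod a b] ++ Δ) θ := by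
  rcases h with h | h
  · exact .inl (.prod_left h)
  · right; simp [LambekFormula.size] at h ⊢; omega

end DerivableOrLarge

/-- From depth `t` on, the word `Λ` may replace the word `Γ` in any antecedent. -/
def Refines {α : Type*} (N t : ℕ) (Λ Γ : List (LambekFormula α)) : Prop :=
  ∀ s, t ≤ s → ∀ Δ Θ θ, DerivableOrLarge N s (Δ ++ Γ ++ Θ) θ →
    DerivableOrLarge N s (Δ ++ Λ ++ Θ) θ

/-- From depth `t` on, every sequent whose antecedent contains the word `Λ` is derivable or
large. -/
def Trivializes {α : Type*} (N t : ℕ) (Λ : List (LambekFormula α)) : Prop :=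
  ∀ s, t ≤ s → ∀ Δ Θ θ, DerivableOrLarge N s (Δ ++ Λ ++ Θ) θ

theorem Refines.refl {α : Type*} (N t : ℕ) (Λ : List (LambekFormula α)) : Refines N t Λ Λ :=
  fun _ _ _ _ _ h => h

theorem Trivializes.of_le {α : Type*} {N t : ℕ} (h : N ≤ t) (Λ : List (LambekFormula α)) :
    Trivializes N t Λ :=
  fun _ hs _ _ _ => .of_le (h.trans hs)

theorem Trivializes.refines {α : Type*} {N t : ℕ} {Λ : List (LambekFormula α)}
    (h : Trivializes N t Λ) (Γ : List (LambekFormula α)) : Refines N t Λ Γ :=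
  fun s hs Δ Θ θ _ => h s hs Δ Θ θ

/-! ### Labelled frames and the truth lemma -/

/-- A transitive relation whose pairs are labelled by antecedents and whose points have a depth,
saturated with respect to a set `S` of formulas at depths below `N`. -/
structure LabelledFrame {α : Type*} (N : ℕ) (S : Set (LambekFormula α)) (W : Type) where
  rel : W → W → Prop
  word : W → W → List (LambekFormula α)
  depth : W → ℕ
  trans : ∀ {x y z}, rel x y → rel y z → rel x z
  word_ne_nil : ∀ {x y}, rel x y → max (depth x) (depth y) < N → word x y ≠ []
  -- The assumption may be as deep as `m`: if `m` was inserted to split a product, this depth pays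
  -- for `prod_left`.
  split : ∀ {z m u}, rel z m → rel m u → ∀ t, max (depth z) (depth u) ≤ t → ∀ Δ Θ θ,
    DerivableOrLarge N (max t (depth m)) (Δ ++ (word z m ++ word m u) ++ Θ) θ →
    DerivableOrLarge N t (Δ ++ word z u ++ Θ) θ
  exists_pred : ∀ {x y}, rel x y → max (depth x) (depth y) < N → ∀ a ∈ S, ∃ z, rel z x ∧
    depth z ≤ max (depth x) (depth y) + 1 ∧ word z x = [a] ∧ word z y = a :: word x y
  exists_succ : ∀ {x y}, rel x y → max (depth x) (depth y) < N → ∀ a ∈ S, ∃ z, rel y z ∧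
    depth z ≤ max (depth x) (depth y) + 1 ∧ word y z = [a] ∧ word x z = word x y ++ [a]
  exists_mid : ∀ {x y}, rel x y → ∀ a b, .prod a b ∈ S →
    Refines N (max (depth x) (depth y)) (word x y) [.prod a b] →
    ∃ m, rel x m ∧ rel m y ∧ Refines N (max (depth x) (depth m)) (word x m) [a] ∧
      Refines N (max (depth m) (depth y)) (word m y) [b]

namespace LabelledFrame

variable {α : Type*} {N : ℕ} {S : Set (LambekFormula α)} {W : Type}

/-- The algebra of all subrelations of the relation of a serial frame. -/
def algebra (F : LabelledFrame N S W) (hF : ∀ x, ∃ y, F.rel x y) : RelResiduatedSemigroup W :=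
  have hU : ⋃₀ {a : SetRel W W | a ⊆ {p | F.rel p.1 p.2}} = {p | F.rel p.1 p.2} :=
    Set.Subset.antisymm (Set.sUnion_subset fun _ h => h)
      (Set.subset_sUnion_of_mem (Set.mem_ofPred.2 subset_rfl))
  { carrier := {a | a ⊆ {p | F.rel p.1 p.2}}
    trans := by
      rw [hU]
      exact fun _ _ _ => F.trans
    dom_eq := by
      rw [hU]
      exact hF
    comp_mem := by
      rintro a ha b hb ⟨x, z⟩ ⟨y, hxy, hyz⟩
      have h₁ : F.rel x y := ha hxy
      have h₂ : F.rel y z := hb hyz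
      exact F.trans h₁ h₂
    ldiv_mem := by
      intro a _ b _
      rw [hU]
      exact fun _ h => h.1
    rdiv_mem := by
      intro a _ b _
      rw [hU]
      exact fun _ h => h.1 }

theorem mem_sUnion_algebra (F : LabelledFrame N S W) (hF : ∀ x, ∃ y, F.rel x y) {p : W × W} :
    p ∈ ⋃₀ (F.algebra hF).carrier ↔ F.rel p.1 p.2 :=
  ⟨fun ⟨_, ha, hp⟩ => ha hp, fun h => ⟨{p | F.rel p.1 p.2}, fun _ h => h, h⟩⟩

/-- A variable holds at a pair whose label derives it. -/
def valuation (F : LabelledFrame N S W) (hF : ∀ x, ∃ y, F.rel x y) (p : α) :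
    (F.algebra hF).carrier :=
  ⟨{q | F.rel q.1 q.2 ∧ DerivableOrLarge N (max (F.depth q.1) (F.depth q.2)) (F.word q.1 q.2)
    (.var p)}, fun _ h => h.1⟩

theorem rel_of_mem_eval (F : LabelledFrame N S W) (hF : ∀ x, ∃ y, F.rel x y)
    {c : LambekFormula α} {x y : W} (h : (x, y) ∈ (F.algebra hF).eval (F.valuation hF) c) :
    F.rel x y :=
  (F.algebra hF).eval_mem (F.valuation hF) c h

/-- The first half uses the left rules and `split`, or a midpoint for a product. The second half
evaluates a residual at a witness one level deeper, a loss that the right rule makes good; at depth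
`N` nothing is left to prove. -/
theorem mem_eval_and_derivableOrLarge (F : LabelledFrame N S W) (hF : ∀ x, ∃ y, F.rel x y)
    (hS : ∀ a ∈ S, ∀ b ∈ a.subformulas, b ∈ S) (c : LambekFormula α) (hc : c ∈ S) (x y : W)
    (hxy : F.rel x y) :
    (Refines N (max (F.depth x) (F.depth y)) (F.word x y) [c] →
      (x, y) ∈ (F.algebra hF).eval (F.valuation hF) c) ∧
    ((x, y) ∈ (F.algebra hF).eval (F.valuation hF) c →
      DerivableOrLarge N (max (F.depth x) (F.depth y)) (F.word x y) c) := by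
  induction c generalizing x y with
  | var p =>
    refine ⟨fun h => ⟨hxy, ?_⟩, fun h => h.2⟩
    simpa using h _ le_rfl [] [] (.var p) (by simpa using DerivableOrLarge.ax)
  | ldiv a b iha ihb =>
    have ha : a ∈ S := hS _ hc _ (by simp [LambekFormula.subformulas, a.mem_subformulas_self])
    have hb : b ∈ S := hS _ hc _ (by simp [LambekFormula.subformulas, b.mem_subformulas_self])
    constructor
    · refine fun h => ⟨(F.mem_sUnion_algebra hF).2 hxy, fun z hz => ?_⟩
      have hzx : F.rel z x := F.rel_of_mem_eval hF hz
      refine (ihb hb z y (F.trans hzx hxy)).1 fun t ht Δ Θ θ hθ => ?_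
      -- After the split at `x` the depth dominates those of `x`, `y` and `z`, so `h` and the
      -- induction hypothesis for `a` both apply.
      refine F.split hzx hxy t ht Δ Θ θ ?_
      have h' := h (max t (F.depth x)) (by omega) (Δ ++ F.word z x) Θ θ
      have ha' := ((iha ha z x hzx).2 hz).mono (s := max t (F.depth x)) (by omega)
      have := DerivableOrLarge.ldiv_left ha' (hθ.mono (le_max_left t (F.depth x)))
      simpa using h' (by simpa using this)
    · intro h
      by_cases hN : max (F.depth x) (F.depth y) < N
      · obtain ⟨z, hzx, hd, hw, hw'⟩ := F.exists_pred hxy hN a ha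
        refine .ldiv_right (F.word_ne_nil hxy hN) ?_
        have hz := h.2 z ((iha ha z x hzx).1 (by rw [hw]; exact .refl _ _ _))
        rw [← hw']
        exact ((ihb hb z y (F.trans hzx hxy)).2 hz).mono (by omega)
      · exact .of_le (by omega)
  | rdiv b a ihb iha =>
    have ha : a ∈ S := hS _ hc _ (by simp [LambekFormula.subformulas, a.mem_subformulas_self])
    have hb : b ∈ S := hS _ hc _ (by simp [LambekFormula.subformulas, b.mem_subformulas_self])
    constructor
    · refine fun h => ⟨(F.mem_sUnion_algebra hF).2 hxy, fun z hz => ?_⟩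
      have hyz : F.rel y z := F.rel_of_mem_eval hF hz
      refine (ihb hb x z (F.trans hxy hyz)).1 fun t ht Δ Θ θ hθ => ?_
      refine F.split hxy hyz t ht Δ Θ θ ?_
      have h' := h (max t (F.depth y)) (by omega) Δ (F.word y z ++ Θ) θ
      have ha' := ((iha ha y z hyz).2 hz).mono (s := max t (F.depth y)) (by omega)
      have := DerivableOrLarge.rdiv_left ha' (hθ.mono (le_max_left t (F.depth y)))
      simpa using h' (by simpa using this)
    · intro h
      by_cases hN : max (F.depth x) (F.depth y) < N
      · obtain ⟨z, hyz, hd, hw, hw'⟩ := F.exists_succ hxy hN a ha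
        refine .rdiv_right (F.word_ne_nil hxy hN) ?_
        have hz := h.2 z ((iha ha y z hyz).1 (by rw [hw]; exact .refl _ _ _))
        rw [← hw']
        exact ((ihb hb x z (F.trans hxy hyz)).2 hz).mono (by omega)
      · exact .of_le (by omega)
  | prod a b iha ihb =>
    have ha : a ∈ S := hS _ hc _ (by simp [LambekFormula.subformulas, a.mem_subformulas_self])
    have hb : b ∈ S := hS _ hc _ (by simp [LambekFormula.subformulas, b.mem_subformulas_self])
    constructor
    · intro h
      obtain ⟨m, hxm, hmy, h₁, h₂⟩ := F.exists_mid hxy a b hc h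
      exact ⟨m, (iha ha x m hxm).1 h₁, (ihb hb m y hmy).1 h₂⟩
    · rintro ⟨m, h₁, h₂⟩
      have hxm : F.rel x m := F.rel_of_mem_eval hF h₁
      have hmy : F.rel m y := F.rel_of_mem_eval hF h₂
      have h₁' := (iha ha x m hxm).2 h₁
      have h₂' := (ihb hb m y hmy).2 h₂
      have := F.split hxm hmy (max (F.depth x) (F.depth y)) le_rfl [] [] (.prod a b) (by
        simpa using DerivableOrLarge.prod_right
          (h₁'.mono (s := max (max (F.depth x) (F.depth y)) (F.depth m)) (by omega))
          (h₂'.mono (by omega)))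
      simpa using this

end LabelledFrame

/-! ### Construction of the stages -/

/-- A finite partial order whose pairs are labelled by antecedents and whose points have a depth
of at most `k`, saturated with respect to the formulas `f i` at depths below `k`. -/
structure StageFrame {α : Type*} {ι : Type} (N : ℕ) (f : ι → LambekFormula α) (k : ℕ) where
  Point : Type
  finite : Finite Point
  le : Point → Point → Prop
  word : Point → Point → List (LambekFormula α)
  depth : Point → ℕ
  root : Point
  depth_root : depth root = 0
  depth_le : ∀ x, depth x ≤ k
  refl : ∀ x, le x x
  trans : ∀ {x y z}, le x y → le y z → le x z
  antisymm : ∀ {x y}, le x y → le y x → x = y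
  word_self : ∀ x, word x x = []
  word_ne_nil : ∀ {x y}, le x y → x ≠ y → word x y ≠ []
  split : ∀ {z m u}, le z m → le m u → ∀ t, depth z ≤ t → depth u ≤ t → ∀ Δ Θ θ,
    DerivableOrLarge N (max t (depth m)) (Δ ++ (word z m ++ word m u) ++ Θ) θ →
    DerivableOrLarge N t (Δ ++ word z u ++ Θ) θ
  exists_pred : ∀ x, depth x < k → ∀ i, ∃ z, le z x ∧ z ≠ x ∧ depth z = depth x + 1 ∧
    ∀ y, le x y → word z y = f i :: word x y
  exists_succ : ∀ x, depth x < k → ∀ i, ∃ z, le x z ∧ z ≠ x ∧ depth z = depth x + 1 ∧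
    ∀ y, le y x → word y z = word y x ++ [f i]
  exists_mid : ∀ x y i j, le x y → x ≠ y → max (depth x) (depth y) < k →
    Refines N (max (depth x) (depth y)) (word x y) [.prod (f i) (f j)] →
    ∃ m, le x m ∧ x ≠ m ∧ le m y ∧ m ≠ y ∧ word x m = [f i] ∧ word m y = [f j]

namespace StageFrame

variable {α : Type*} {ι : Type} {N k : ℕ} {f : ι → LambekFormula α}

/-- The frame with a single point. -/
def single (N : ℕ) (f : ι → LambekFormula α) : StageFrame N f 0 where
  Point := Unit
  finite := inferInstance
  le _ _ := True
  word _ _ := []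
  depth _ := 0
  root := ()
  depth_root := rfl
  depth_le _ := le_rfl
  refl _ := trivial
  trans _ _ := trivial
  antisymm _ _ := rfl
  word_self _ := rfl
  word_ne_nil _ h := absurd rfl h
  split _ _ t _ _ Δ Θ θ h := by simpa using h
  exists_pred _ h := absurd h (Nat.not_lt_zero _)
  exists_succ _ h := absurd h (Nat.not_lt_zero _)
  exists_mid _ _ _ _ _ h := absurd rfl h

/-- The pairs of a lower and an upper attachment for which a new point is added: only an upper
one, only a lower one, or both around a pair that has to satisfy a product. -/
def IsCut (F : StageFrame N f k) : Option (F.Point × ι) × Option (ι × F.Point) → Prop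
  | (none, none) => False
  | (none, some (_, y)) => F.depth y = k
  | (some (x, _), none) => F.depth x = k
  | (some (x, i), some (j, y)) => F.le x y ∧ x ≠ y ∧ max (F.depth x) (F.depth y) = k ∧
      Refines N k (F.word x y) [.prod (f i) (f j)]

/-- The points of the next stage. -/
abbrev NextPoint (F : StageFrame N f k) : Type := F.Point ⊕ {c // F.IsCut c}

/-- The greatest old point below a point, with the label in between. -/
def lower (F : StageFrame N f k) : F.NextPoint → Option (F.Point × List (LambekFormula α))
  | .inl x => some (x, [])
  | .inr c => c.1.1.map fun p => (p.1, [f p.2])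

/-- The least old point above a point, with the label in between. -/
def upper (F : StageFrame N f k) : F.NextPoint → Option (List (LambekFormula α) × F.Point)
  | .inl x => some ([], x)
  | .inr c => c.1.2.map fun p => ([f p.1], p.2)

/-- The depth in the next stage. -/
def nextDepth (F : StageFrame N f k) : F.NextPoint → ℕ
  | .inl x => F.depth x
  | .inr _ => k + 1

/-- The order of the next stage: two points are comparable through old points. -/
def nextLe (F : StageFrame N f k) (p q : F.NextPoint) : Prop :=
  p = q ∨ ∃ β y x γ, F.upper p = some (β, y) ∧ F.lower q = some (x, γ) ∧ F.le y x

open Classical in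
/-- The labels of the next stage. -/
noncomputable def nextWord (F : StageFrame N f k) (p q : F.NextPoint) : List (LambekFormula α) :=
  if p = q then [] else
    match F.upper p, F.lower q with
    | some (β, y), some (x, γ) => β ++ F.word y x ++ γ
    -- Distinct comparable points never reach this default.
    | _, _ => []

theorem nextWord_self (F : StageFrame N f k) (p : F.NextPoint) : F.nextWord p p = [] := by
  simp [nextWord]

theorem nextWord_of_ne (F : StageFrame N f k) {p q : F.NextPoint} (h : p ≠ q)
    {β γ : List (LambekFormula α)} {y x : F.Point} (hp : F.upper p = some (β, y))
    (hq : F.lower q = some (x, γ)) : F.nextWord p q = β ++ F.word y x ++ γ := by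
  simp [nextWord, h, hp, hq]

theorem depth_le_of_upper (F : StageFrame N f k) {p : F.NextPoint}
    {β : List (LambekFormula α)} {y : F.Point} (hp : F.upper p = some (β, y)) :
    F.depth y ≤ F.nextDepth p := by
  rcases p with x | c
  · obtain ⟨-, rfl⟩ : [] = β ∧ x = y := by simpa [upper] using hp
    exact le_rfl
  · exact (F.depth_le y).trans (Nat.le_succ k)

theorem depth_le_of_lower (F : StageFrame N f k) {p : F.NextPoint}
    {γ : List (LambekFormula α)} {x : F.Point} (hp : F.lower p = some (x, γ)) :
    F.depth x ≤ F.nextDepth p := by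
  rcases p with y | c
  · obtain ⟨rfl, -⟩ : y = x ∧ [] = γ := by simpa [lower] using hp
    exact le_rfl
  · exact (F.depth_le x).trans (Nat.le_succ k)

/-- Only an old point or a product midpoint has neighbours on both sides. For a midpoint,
`prod_left` fuses the two letters at the cost of one level, and the label of the surrounding pair
then replaces the product. -/
theorem le_of_lower_of_upper (F : StageFrame N f k) {p : F.NextPoint}
    {β γ : List (LambekFormula α)} {x y : F.Point} (h₁ : F.lower p = some (x, γ))
    (h₂ : F.upper p = some (β, y)) : F.le x y ∧ (x = y → p = .inl x) ∧
      ∀ t Δ Θ θ, DerivableOrLarge N (max t (F.nextDepth p)) (Δ ++ (γ ++ β) ++ Θ) θ →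
        DerivableOrLarge N (max (max t (F.depth x)) (F.depth y)) (Δ ++ F.word x y ++ Θ) θ := by
  rcases p with z | ⟨⟨_ | ⟨x', i⟩, _ | ⟨j, y'⟩⟩, hc⟩
  · obtain ⟨rfl, rfl⟩ : z = x ∧ [] = γ := by simpa [lower] using h₁
    obtain ⟨rfl, rfl⟩ : [] = β ∧ z = y := by simpa [upper] using h₂
    refine ⟨F.refl z, fun _ => rfl, fun t Δ Θ θ h => ?_⟩
    simp only [F.word_self]
    exact h.mono (by simp [nextDepth])
  · exact hc.elim
  · simp [lower] at h₁
  · simp [upper] at h₂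
  · obtain ⟨rfl, rfl⟩ : x' = x ∧ [f i] = γ := by simpa [lower] using h₁
    obtain ⟨rfl, rfl⟩ : [f j] = β ∧ y' = y := by simpa [upper] using h₂
    obtain ⟨hle, hne, hd, hr⟩ := hc
    refine ⟨hle, fun h => absurd h hne, fun t Δ Θ θ h => ?_⟩
    refine hr _ (by omega) Δ Θ θ (DerivableOrLarge.prod_left ?_)
    refine DerivableOrLarge.mono ?_ h
    simp only [nextDepth]
    omega

theorem nextLe_trans (F : StageFrame N f k) {p q r : F.NextPoint} (h₁ : F.nextLe p q)
    (h₂ : F.nextLe q r) : F.nextLe p r := by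
  rcases h₁ with rfl | ⟨β, y, x, γ, hp, hq, hle⟩
  · exact h₂
  · rcases h₂ with rfl | ⟨β', y', x', γ', hq', hr, hle'⟩
    · exact .inr ⟨β, y, x, γ, hp, hq, hle⟩
    · exact .inr ⟨β, y, x', γ', hp, hr,
        F.trans hle (F.trans (F.le_of_lower_of_upper hq hq').1 hle')⟩

/-- A cycle collapses all old points on it to one, whereas the two ends of a product midpoint are
distinct; so no new point lies on a cycle through old ones. -/
theorem nextLe_antisymm (F : StageFrame N f k) {p q : F.NextPoint} (h₁ : F.nextLe p q)
    (h₂ : F.nextLe q p) : p = q := by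
  rcases h₁ with rfl | ⟨β, y, x, γ, hp, hq, hle⟩
  · rfl
  · rcases h₂ with rfl | ⟨β', y', x', γ', hq', hp', hle'⟩
    · rfl
    · obtain ⟨h₃, h₄, -⟩ := F.le_of_lower_of_upper hq hq'
      obtain ⟨h₅, h₆, -⟩ := F.le_of_lower_of_upper hp' hp
      rw [h₄ (F.antisymm h₃ (F.trans hle' (F.trans h₅ hle))),
        h₆ (F.antisymm h₅ (F.trans hle (F.trans h₃ hle')))]
      exact congrArg _ (F.antisymm (F.trans h₅ hle) (F.trans h₃ hle'))

/-- In the main case `m` is first replaced by the label between its old neighbours, and two old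
splits then remove these neighbours, each lowering the depth accordingly. -/
theorem next_split (F : StageFrame N f k) {z m u : F.NextPoint} (h₁ : F.nextLe z m)
    (h₂ : F.nextLe m u) (t : ℕ) (hz : F.nextDepth z ≤ t) (hu : F.nextDepth u ≤ t)
    (Δ Θ : List (LambekFormula α)) (θ : LambekFormula α)
    (h : DerivableOrLarge N (max t (F.nextDepth m))
      (Δ ++ (F.nextWord z m ++ F.nextWord m u) ++ Θ) θ) :
    DerivableOrLarge N t (Δ ++ F.nextWord z u ++ Θ) θ := by
  by_cases hzm : z = m
  · subst hzm
    rw [nextWord_self] at h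
    exact h.mono (by omega)
  by_cases hmu : m = u
  · subst hmu
    rw [nextWord_self, List.append_nil] at h
    exact h.mono (by omega)
  have hzu : z ≠ u := by
    rintro rfl
    exact hzm (F.nextLe_antisymm h₁ h₂)
  obtain ⟨β, y, x, γ, hp, hq, hle⟩ := h₁.resolve_left hzm
  obtain ⟨β', y', x', γ', hq', hr, hle'⟩ := h₂.resolve_left hmu
  obtain ⟨hxy, -, hcut⟩ := F.le_of_lower_of_upper hq hq'
  rw [F.nextWord_of_ne hzm hp hq, F.nextWord_of_ne hmu hq' hr] at h
  rw [F.nextWord_of_ne hzu hp hr]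
  have hy := (F.depth_le_of_upper hp).trans hz
  have hx' := (F.depth_le_of_lower hr).trans hu
  have h₃ := hcut t (Δ ++ β ++ F.word y x) (F.word y' x' ++ γ' ++ Θ) θ (by simpa using h)
  have h₄ := F.split hxy hle' (max t (F.depth x)) (by omega) (by omega) (Δ ++ β ++ F.word y x)
    (γ' ++ Θ) θ (by simpa using h₃)
  have h₅ := F.split hle (F.trans hxy hle') t hy hx' (Δ ++ β) (γ' ++ Θ) θ (by simpa using h₄)
  simpa using h₅

theorem nextWord_ne_nil (F : StageFrame N f k) {p q : F.NextPoint} (h : F.nextLe p q)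
    (hpq : p ≠ q) : F.nextWord p q ≠ [] := by
  obtain ⟨β, y, x, γ, hp, hq, hle⟩ := h.resolve_left hpq
  rw [F.nextWord_of_ne hpq hp hq]
  rcases p with p | ⟨⟨c₁, _ | ⟨i, y'⟩⟩, hc⟩
  · rcases q with q | ⟨⟨_ | ⟨x', j⟩, c₂⟩, hc⟩
    · obtain ⟨rfl, rfl⟩ : [] = β ∧ p = y := by simpa [upper] using hp
      obtain ⟨rfl, rfl⟩ : q = x ∧ [] = γ := by simpa [lower] using hq
      simpa using F.word_ne_nil hle fun h => hpq (congrArg _ h)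
    · simp [lower] at hq
    · obtain ⟨rfl, rfl⟩ : x' = x ∧ [f j] = γ := by simpa [lower] using hq
      simp
  · simp [upper] at hp
  · obtain ⟨rfl, rfl⟩ : [f i] = β ∧ y' = y := by simpa [upper] using hp
    simp

theorem nextLe_inl_left_iff (F : StageFrame N f k) {p : F.Point} {q : F.NextPoint} :
    F.nextLe (.inl p) q ↔ ∃ x γ, F.lower q = some (x, γ) ∧ F.le p x := by
  constructor
  · rintro (rfl | ⟨β, y, x, γ, hp, hq, hle⟩)
    · exact ⟨p, [], rfl, F.refl p⟩
    · obtain ⟨rfl, rfl⟩ : [] = β ∧ p = y := by simpa [upper] using hp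
      exact ⟨x, γ, hq, hle⟩
  · rintro ⟨x, γ, hq, hle⟩
    exact .inr ⟨[], p, x, γ, rfl, hq, hle⟩

theorem nextLe_inl_right_iff (F : StageFrame N f k) {p : F.Point} {q : F.NextPoint} :
    F.nextLe q (.inl p) ↔ ∃ β y, F.upper q = some (β, y) ∧ F.le y p := by
  constructor
  · rintro (rfl | ⟨β, y, x, γ, hq, hp, hle⟩)
    · exact ⟨[], p, rfl, F.refl p⟩
    · obtain ⟨rfl, rfl⟩ : p = x ∧ [] = γ := by simpa [lower] using hp
      exact ⟨β, y, hq, hle⟩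
  · rintro ⟨β, y, hq, hle⟩
    exact .inr ⟨β, y, p, [], hq, rfl, hle⟩

theorem nextWord_inl_left (F : StageFrame N f k) {p x : F.Point} {q : F.NextPoint}
    {γ : List (LambekFormula α)} (hq : F.lower q = some (x, γ)) :
    F.nextWord (.inl p) q = F.word p x ++ γ := by
  by_cases h : .inl p = q
  · subst h
    obtain ⟨rfl, rfl⟩ : p = x ∧ [] = γ := by simpa [lower] using hq
    simp [nextWord_self, F.word_self]
  · rw [F.nextWord_of_ne h rfl hq, List.nil_append]

theorem nextWord_inl_right (F : StageFrame N f k) {p y : F.Point} {q : F.NextPoint}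
    {β : List (LambekFormula α)} (hq : F.upper q = some (β, y)) :
    F.nextWord q (.inl p) = β ++ F.word y p := by
  by_cases h : q = .inl p
  · subst h
    obtain ⟨rfl, rfl⟩ : [] = β ∧ p = y := by simpa [upper] using hq
    simp [nextWord_self, F.word_self]
  · rw [F.nextWord_of_ne h hq rfl, List.append_nil]

theorem nextLe_inl_inl (F : StageFrame N f k) {p q : F.Point} :
    F.nextLe (.inl p) (.inl q) ↔ F.le p q := by
  rw [nextLe_inl_left_iff]
  constructor
  · rintro ⟨x, γ, hq, hle⟩
    obtain ⟨rfl, rfl⟩ : q = x ∧ [] = γ := by simpa [lower] using hq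
    exact hle
  · exact fun h => ⟨q, [], rfl, h⟩

theorem nextWord_inl_inl (F : StageFrame N f k) (p q : F.Point) :
    F.nextWord (.inl p) (.inl q) = F.word p q := by
  rw [F.nextWord_inl_left rfl, List.append_nil]

theorem next_exists_pred (F : StageFrame N f k) (x : F.NextPoint) (hx : F.nextDepth x < k + 1)
    (i : ι) : ∃ z, F.nextLe z x ∧ z ≠ x ∧ F.nextDepth z = F.nextDepth x + 1 ∧
      ∀ y, F.nextLe x y → F.nextWord z y = f i :: F.nextWord x y := by
  rcases x with x | c
  · rcases (F.depth_le x).lt_or_eq with h | h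
    · obtain ⟨z, hle, hne, hd, hw⟩ := F.exists_pred x h i
      refine ⟨.inl z, F.nextLe_inl_inl.2 hle, fun h => hne (Sum.inl_injective h), hd, ?_⟩
      intro y hy
      obtain ⟨y', γ, hy', hle'⟩ := F.nextLe_inl_left_iff.1 hy
      rw [F.nextWord_inl_left hy', F.nextWord_inl_left hy', hw _ hle', List.cons_append]
    · refine ⟨.inr ⟨(none, some (i, x)), h⟩, ?_, Sum.inr_ne_inl, ?_, ?_⟩
      · exact F.nextLe_inl_right_iff.2 ⟨[f i], x, rfl, F.refl x⟩
      · simp [nextDepth, h]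
      · intro y hy
        obtain ⟨y', γ, hy', hle'⟩ := F.nextLe_inl_left_iff.1 hy
        rw [F.nextWord_inl_left hy', F.nextWord_of_ne (β := [f i]) (y := x) ?_ rfl hy']
        · simp
        · rintro rfl
          simp [lower] at hy'
  · simp [nextDepth] at hx

theorem next_exists_succ (F : StageFrame N f k) (x : F.NextPoint) (hx : F.nextDepth x < k + 1)
    (i : ι) : ∃ z, F.nextLe x z ∧ z ≠ x ∧ F.nextDepth z = F.nextDepth x + 1 ∧
      ∀ y, F.nextLe y x → F.nextWord y z = F.nextWord y x ++ [f i] := by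
  rcases x with x | c
  · rcases (F.depth_le x).lt_or_eq with h | h
    · obtain ⟨z, hle, hne, hd, hw⟩ := F.exists_succ x h i
      refine ⟨.inl z, F.nextLe_inl_inl.2 hle, fun h => hne (Sum.inl_injective h), hd, ?_⟩
      intro y hy
      obtain ⟨β, y', hy', hle'⟩ := F.nextLe_inl_right_iff.1 hy
      rw [F.nextWord_inl_right hy', F.nextWord_inl_right hy', hw _ hle', List.append_assoc]
    · refine ⟨.inr ⟨(some (x, i), none), h⟩, ?_, Sum.inr_ne_inl, ?_, ?_⟩
      · exact F.nextLe_inl_left_iff.2 ⟨x, [f i], rfl, F.refl x⟩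
      · simp [nextDepth, h]
      · intro y hy
        obtain ⟨β, y', hy', hle'⟩ := F.nextLe_inl_right_iff.1 hy
        rw [F.nextWord_inl_right hy', F.nextWord_of_ne (γ := [f i]) (x := x) ?_ hy' rfl]
        rintro rfl
        simp [upper] at hy'
  · simp [nextDepth] at hx

/-- The depth bound leaves only old pairs: those below depth `k` already have midpoints, and those
of depth `k` receive a cut. -/
theorem next_exists_mid (F : StageFrame N f k) (x y : F.NextPoint) (i j : ι)
    (hxy : F.nextLe x y) (hne : x ≠ y) (hd : max (F.nextDepth x) (F.nextDepth y) < k + 1)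
    (hr : Refines N (max (F.nextDepth x) (F.nextDepth y)) (F.nextWord x y)
      [.prod (f i) (f j)]) :
    ∃ m, F.nextLe x m ∧ x ≠ m ∧ F.nextLe m y ∧ m ≠ y ∧ F.nextWord x m = [f i] ∧
      F.nextWord m y = [f j] := by
  rcases x with x | c
  · rcases y with y | c
    · rw [nextLe_inl_inl] at hxy
      rw [nextWord_inl_inl] at hr
      simp only [nextDepth] at hd hr
      have hne' : x ≠ y := fun h => hne (congrArg _ h)
      rcases (Nat.lt_succ_iff.1 hd).lt_or_eq with h | h
      · obtain ⟨m, h₁, h₂, h₃, h₄, h₅, h₆⟩ := F.exists_mid x y i j hxy hne' h hr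
        refine ⟨.inl m, F.nextLe_inl_inl.2 h₁, fun h => h₂ (Sum.inl_injective h),
          F.nextLe_inl_inl.2 h₃, fun h => h₄ (Sum.inl_injective h), ?_, ?_⟩
        · rw [nextWord_inl_inl, h₅]
        · rw [nextWord_inl_inl, h₆]
      · refine ⟨.inr ⟨(some (x, i), some (j, y)), hxy, hne', h, by rwa [h] at hr⟩, ?_, Sum.inl_ne_inr, ?_,
          Sum.inr_ne_inl, ?_, ?_⟩
        · exact F.nextLe_inl_left_iff.2 ⟨x, [f i], rfl, F.refl x⟩
        · exact F.nextLe_inl_right_iff.2 ⟨[f j], y, rfl, F.refl y⟩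
        · rw [F.nextWord_inl_left (x := x) (γ := [f i]) rfl, F.word_self, List.nil_append]
        · rw [F.nextWord_inl_right (y := y) (β := [f j]) rfl, F.word_self, List.append_nil]
    · simp [nextDepth] at hd
  · simp [nextDepth] at hd

/-- The next stage. -/
noncomputable def next [Finite ι] (F : StageFrame N f k) : StageFrame N f (k + 1) where
  Point := F.NextPoint
  finite := by
    have := F.finite
    infer_instance
  le := F.nextLe
  word := F.nextWord
  depth := F.nextDepth
  root := .inl F.root
  depth_root := F.depth_root
  depth_le := by
    rintro (x | c)
    · exact (F.depth_le x).trans (Nat.le_succ k)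
    · exact le_rfl
  refl _ := .inl rfl
  trans := F.nextLe_trans
  antisymm := F.nextLe_antisymm
  word_self := F.nextWord_self
  word_ne_nil := F.nextWord_ne_nil
  split := F.next_split
  exists_pred := F.next_exists_pred
  exists_succ := F.next_exists_succ
  exists_mid := F.next_exists_mid

/-- The frame of a given stage, starting from a single point. -/
noncomputable def stage [Finite ι] (N : ℕ) (f : ι → LambekFormula α) :
    (k : ℕ) → StageFrame N f k
  | 0 => single N f
  | k + 1 => (stage N f k).next

/-! ### Doubling the last stage -/

/-- The strict order of a frame. -/
def Lt (F : StageFrame N f k) (x y : F.Point) : Prop := F.le x y ∧ x ≠ y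

/-- A pair every label of which makes sequents derivable or large. -/
def Trivial (F : StageFrame N f k) (x y : F.Point) : Prop :=
  F.Lt x y ∧ Trivializes N (max (F.depth x) (F.depth y)) (F.word x y)

theorem Lt.trans_le {F : StageFrame N f k} {x y z : F.Point} (h₁ : F.Lt x y) (h₂ : F.le y z) :
    F.Lt x z :=
  ⟨F.trans h₁.1 h₂, by rintro rfl; exact h₁.2 (F.antisymm h₁.1 h₂)⟩

theorem Lt.le_trans {F : StageFrame N f k} {x y z : F.Point} (h₁ : F.le x y) (h₂ : F.Lt y z) :
    F.Lt x z :=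
  ⟨F.trans h₁ h₂.1, by rintro rfl; exact h₂.2 (F.antisymm h₂.1 h₁)⟩

/-- Trivial pairs absorb the order on either side, by `split`. This is what makes `doubleRel`
transitive; a mere bound on depths could be lost in composition with a shallow point. -/
theorem Trivial.trans_le {F : StageFrame N f k} {x y z : F.Point} (h₁ : F.Trivial x y)
    (h₂ : F.le y z) : F.Trivial x z := by
  refine ⟨h₁.1.trans_le h₂, fun t ht Δ Θ θ => F.split h₁.1.1 h₂ t (by omega) (by omega) Δ Θ θ ?_⟩
  simpa using h₁.2 (max t (F.depth y)) (by omega) Δ (F.word y z ++ Θ) θ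

theorem Trivial.le_trans {F : StageFrame N f k} {x y z : F.Point} (h₁ : F.le x y)
    (h₂ : F.Trivial y z) : F.Trivial x z := by
  refine ⟨Lt.le_trans h₁ h₂.1, fun t ht Δ Θ θ => F.split h₁ h₂.1.1 t (by omega) (by omega) Δ Θ θ ?_⟩
  simpa using h₂.2 (max t (F.depth y)) (by omega) (Δ ++ F.word x y) Θ θ

theorem trivial_of_le (F : StageFrame N f k) {x y : F.Point} (h : F.Lt x y)
    (hN : N ≤ max (F.depth x) (F.depth y)) : F.Trivial x y :=
  ⟨h, .of_le hN _⟩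

/-- The relation of the frame in which every point gets a reflexive companion above it. -/
def doubleRel (F : StageFrame N f k) : F.Point × Bool → F.Point × Bool → Prop
  | (x, false), (y, false) => F.Lt x y
  | (x, false), (y, true) => F.le x y
  | (x, true), (y, false) => F.Trivial x y
  | (x, true), (y, true) => x = y ∨ F.Trivial x y

/-- The depth in the doubled frame; companions are as deep as possible. -/
def doubleDepth (F : StageFrame N f k) : F.Point × Bool → ℕ
  | (x, false) => F.depth x
  | (_, true) => N

theorem doubleRel_trans (F : StageFrame N f k) {x y z : F.Point × Bool}
    (h₁ : F.doubleRel x y) (h₂ : F.doubleRel y z) : F.doubleRel x z := by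
  obtain ⟨x, _ | _⟩ := x <;> obtain ⟨y, _ | _⟩ := y <;> obtain ⟨z, _ | _⟩ := z <;>
    simp only [doubleRel] at h₁ h₂ ⊢
  · exact h₁.trans_le h₂.1
  · exact F.trans h₁.1 h₂
  · exact Lt.le_trans h₁ h₂.1
  · rcases h₂ with rfl | h₂
    · exact h₁
    · exact F.trans h₁ h₂.1.1
  · exact h₁.trans_le h₂.1
  · exact .inr (h₁.trans_le h₂)
  · rcases h₁ with rfl | h₁
    · exact h₂
    · exact h₁.trans_le h₂.1.1
  · rcases h₁ with rfl | h₁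
    · exact h₂
    · rcases h₂ with rfl | h₂
      · exact .inr h₁
      · exact .inr (h₁.trans_le h₂.1.1)

theorem doubleRel_of_depth_lt {F : StageFrame N f k} {x y : F.Point × Bool}
    (h : F.doubleRel x y) (hN : max (F.doubleDepth x) (F.doubleDepth y) < N) :
    ∃ x' y', x = (x', false) ∧ y = (y', false) ∧ F.Lt x' y' := by
  obtain ⟨x, _ | _⟩ := x <;> obtain ⟨y, _ | _⟩ := y <;> simp only [doubleDepth] at hN
  · exact ⟨x, y, rfl, rfl, h⟩
  all_goals omega

/-- The doubled frame of the last stage is saturated. -/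
def double (F : StageFrame N f N)
    (hf : ∀ a b, LambekFormula.prod a b ∈ Set.range f → a ∈ Set.range f ∧ b ∈ Set.range f) :
    LabelledFrame N (Set.range f) (F.Point × Bool) where
  rel := F.doubleRel
  word x y := F.word x.1 y.1
  depth := F.doubleDepth
  trans := F.doubleRel_trans
  word_ne_nil h hN := by
    obtain ⟨x, y, rfl, rfl, h⟩ := doubleRel_of_depth_lt h hN
    exact F.word_ne_nil h.1 h.2
  split := by
    intro z m u h₁ h₂ t ht Δ Θ θ h
    by_cases hN : N ≤ t
    · exact .of_le hN
    obtain ⟨z, u, rfl, rfl, h₃⟩ := doubleRel_of_depth_lt (F.doubleRel_trans h₁ h₂) (by omega)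
    simp only [doubleDepth] at ht
    obtain ⟨m, _ | _⟩ := m
    · exact F.split h₁.1 h₂.1 t (by omega) (by omega) Δ Θ θ h
    -- A companion leads down to an ordinary point only along a trivial pair, so the whole pair is
    -- trivial.
    · exact (Trivial.le_trans h₁ h₂).2 t ht Δ Θ θ
  exists_pred := by
    rintro x y h hN _ ⟨i, rfl⟩
    obtain ⟨x, y, rfl, rfl, h⟩ := doubleRel_of_depth_lt h hN
    simp only [doubleDepth] at hN
    obtain ⟨z, hle, hne, hd, hw⟩ := F.exists_pred x (by omega) i
    refine ⟨(z, false), ⟨hle, hne⟩, by simp only [doubleDepth]; omega, ?_, hw y h.1⟩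
    simp only [hw x (F.refl x), F.word_self]
  exists_succ := by
    rintro x y h hN _ ⟨i, rfl⟩
    obtain ⟨x, y, rfl, rfl, h⟩ := doubleRel_of_depth_lt h hN
    simp only [doubleDepth] at hN
    obtain ⟨z, hle, hne, hd, hw⟩ := F.exists_succ y (by omega) i
    refine ⟨(z, false), ⟨hle, hne.symm⟩, by simp only [doubleDepth]; omega, ?_, hw x h.1⟩
    simp only [hw y (F.refl y), F.word_self, List.nil_append]
  exists_mid := by
    intro x y h a b hab hr
    have hcomp {u v : F.Point × Bool} (m : F.Point) (h₁ : F.doubleRel u (m, true))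
        (h₂ : F.doubleRel (m, true) v) : ∃ m, F.doubleRel u m ∧ F.doubleRel m v ∧
        Refines N (max (F.doubleDepth u) (F.doubleDepth m)) (F.word u.1 m.1) [a] ∧
        Refines N (max (F.doubleDepth m) (F.doubleDepth v)) (F.word m.1 v.1) [b] :=
      ⟨(m, true), h₁, h₂, (Trivializes.of_le (le_max_right _ _) _).refines _,
        (Trivializes.of_le (le_max_left _ _) _).refines _⟩
    obtain ⟨x, _ | _⟩ := x <;> obtain ⟨y, _ | _⟩ := y
    · by_cases hN : max (F.depth x) (F.depth y) < N
      · obtain ⟨⟨i, rfl⟩, ⟨j, rfl⟩⟩ := hf a b hab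
        obtain ⟨m, h₁, h₂, h₃, h₄, h₅, h₆⟩ := F.exists_mid x y i j h.1 h.2 hN hr
        refine ⟨(m, false), ⟨h₁, h₂⟩, ⟨h₃, h₄⟩, ?_, ?_⟩
        · rw [h₅]
          exact .refl _ _ _
        · rw [h₆]
          exact .refl _ _ _
      -- A pair of depth `N` may lack a midpoint in the stage, but it is trivial, so the companion
      -- of `x` lies in between.
      · exact hcomp x (F.refl x) (F.trivial_of_le h (not_lt.1 hN))
    · exact hcomp y h (.inl rfl)
    · exact hcomp x (.inl rfl) h
    · exact hcomp x (.inl rfl) h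

theorem doubleRel_serial (F : StageFrame N f k) (x : F.Point × Bool) : ∃ y, F.doubleRel x y :=
  ⟨(x.1, true), match x with
    | (x, false) => F.refl x
    | (_, true) => .inl rfl⟩

end StageFrame

/-! ### Antecedents as paths -/

theorem StageFrame.exists_mem_evalList {α : Type*} {ι : Type} {N : ℕ} {f : ι → LambekFormula α}
    (F : StageFrame N f N)
    (hf : ∀ a b, LambekFormula.prod a b ∈ Set.range f → a ∈ Set.range f ∧ b ∈ Set.range f)
    (hS : ∀ a ∈ Set.range f, ∀ b ∈ a.subformulas, b ∈ Set.range f)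
    (Γ : List (LambekFormula α)) (hΓ : ∀ a ∈ Γ, a ∈ Set.range f) (x : F.Point)
    (hx : F.depth x + Γ.length ≤ N) :
    ∃ y, F.le x y ∧ F.depth y = F.depth x + Γ.length ∧
      ((x, false), (y, false)) ∈ ((F.double hf).algebra F.doubleRel_serial).evalList
        ((F.double hf).valuation F.doubleRel_serial) Γ ∧
      ∀ z, F.le z x → F.word z y = F.word z x ++ Γ := by
  induction Γ generalizing x with
  | nil => exact ⟨x, F.refl x, rfl, rfl, by simp⟩
  | cons a Γ ih =>
    obtain ⟨i, rfl⟩ := hΓ a List.mem_cons_self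
    rw [List.length_cons] at hx
    obtain ⟨m, hxm, hne, hd, hw⟩ := F.exists_succ x (by omega) i
    obtain ⟨y, hmy, hd', hmem, hw'⟩ :=
      ih (fun b hb => hΓ b (List.mem_cons_of_mem _ hb)) m (by omega)
    refine ⟨y, F.trans hxm hmy, by rw [List.length_cons]; omega, ⟨(m, false), ?_, hmem⟩, ?_⟩
    · refine ((F.double hf).mem_eval_and_derivableOrLarge F.doubleRel_serial hS _ ⟨i, rfl⟩ (x, false) (m, false)
        (show F.Lt x m from ⟨hxm, hne.symm⟩)).1 ?_
      have h : F.word x m = [f i] := by rw [hw x (F.refl x), F.word_self, List.nil_append]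
      intro s _ Δ Θ θ hθ
      exact (congrArg (fun w => DerivableOrLarge N s (Δ ++ w ++ Θ) θ) h).mpr hθ
    · intro z hz
      rw [hw' z (F.trans hz hxm), hw z hz, List.append_assoc, List.singleton_append]

/-! ### Soundness -/

namespace RelResiduatedSemigroup

variable {W α : Type*} (A : RelResiduatedSemigroup W) (v : α → A.carrier)

theorem mem_evalList_append {Γ Δ : List (LambekFormula α)} {x z : W} :
    (x, z) ∈ A.evalList v (Γ ++ Δ) ↔
      ∃ y, (x, y) ∈ A.evalList v Γ ∧ (y, z) ∈ A.evalList v Δ := by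
  induction Γ generalizing x with
  | nil =>
    refine ⟨fun h => ⟨x, rfl, h⟩, ?_⟩
    rintro ⟨y, h₁, h₂⟩
    obtain rfl : x = y := h₁
    exact h₂
  | cons a Γ ih =>
    constructor
    · rintro ⟨w, h₁, h₂⟩
      obtain ⟨y, h₃, h₄⟩ := ih.1 h₂
      exact ⟨y, ⟨w, h₁, h₃⟩, h₄⟩
    · rintro ⟨y, ⟨w, h₁, h₃⟩, h₄⟩
      exact ⟨w, h₁, ih.2 ⟨y, h₃, h₄⟩⟩

theorem mem_evalList_singleton {a : LambekFormula α} {x y : W} :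
    (x, y) ∈ A.evalList v [a] ↔ (x, y) ∈ A.eval v a := by
  constructor
  · rintro ⟨w, h₁, h₂⟩
    obtain rfl : w = y := h₂
    exact h₁
  · exact fun h => ⟨y, h, rfl⟩

theorem mem_sUnion_of_mem_eval {a : LambekFormula α} {p : W × W} (h : p ∈ A.eval v a) :
    p ∈ ⋃₀ A.carrier :=
  ⟨_, A.eval_mem v a, h⟩

/-- Residuals are cut down to `R`, so their right rules need this; the empty antecedent denotes the
identity, which need not lie in `R`. -/
theorem mem_sUnion_of_mem_evalList {Γ : List (LambekFormula α)} (hΓ : Γ ≠ []) {x y : W}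
    (h : (x, y) ∈ A.evalList v Γ) : (x, y) ∈ ⋃₀ A.carrier := by
  induction Γ generalizing x with
  | nil => exact absurd rfl hΓ
  | cons a Γ ih =>
    obtain ⟨w, h₁, h₂⟩ := h
    have h₁' := A.mem_sUnion_of_mem_eval v h₁
    rcases eq_or_ne Γ [] with rfl | hΓ'
    · obtain rfl : w = y := h₂
      exact h₁'
    · exact A.trans _ _ _ h₁' (ih hΓ' h₂)

theorem satisfies_of_lambekDerivable {Γ : List (LambekFormula α)} {φ : LambekFormula α}
    (h : LambekDerivable Γ φ) : A.Satisfies v Γ φ := by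
  induction h with
  | ax φ => exact fun p hp => (A.mem_evalList_singleton v).1 hp
  | @ldiv_left Γ Δ Θ φ ψ θ _ _ ih₁ ih₂ =>
    rintro ⟨x, y⟩ h
    obtain ⟨u, h, hΘ⟩ := (A.mem_evalList_append v).1 h
    obtain ⟨w, h, hdiv⟩ := (A.mem_evalList_append v).1 h
    obtain ⟨z, hΔ, hΓ⟩ := (A.mem_evalList_append v).1 h
    have hψ := ((A.mem_evalList_singleton v).1 hdiv).2 z (ih₁ hΓ)
    exact ih₂ ((A.mem_evalList_append v).2 ⟨u, (A.mem_evalList_append v).2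
      ⟨z, hΔ, (A.mem_evalList_singleton v).2 hψ⟩, hΘ⟩)
  | @rdiv_left Γ Δ Θ φ ψ θ _ _ ih₁ ih₂ =>
    rintro ⟨x, y⟩ h
    obtain ⟨u, h, hΘ⟩ := (A.mem_evalList_append v).1 h
    obtain ⟨w, h, hΓ⟩ := (A.mem_evalList_append v).1 h
    obtain ⟨z, hΔ, hdiv⟩ := (A.mem_evalList_append v).1 h
    have hψ := ((A.mem_evalList_singleton v).1 hdiv).2 u (ih₁ hΓ)
    exact ih₂ ((A.mem_evalList_append v).2 ⟨u, (A.mem_evalList_append v).2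
      ⟨z, hΔ, (A.mem_evalList_singleton v).2 hψ⟩, hΘ⟩)
  | ldiv_right hΓ _ ih =>
    rintro ⟨x, y⟩ h
    exact ⟨A.mem_sUnion_of_mem_evalList v hΓ h, fun z hz => ih ⟨x, hz, h⟩⟩
  | rdiv_right hΓ _ ih =>
    rintro ⟨x, y⟩ h
    exact ⟨A.mem_sUnion_of_mem_evalList v hΓ h, fun z hz =>
      ih ((A.mem_evalList_append v).2 ⟨y, h, (A.mem_evalList_singleton v).2 hz⟩)⟩
  | prod_left _ ih =>
    rintro ⟨x, y⟩ h
    obtain ⟨u, h, hΔ⟩ := (A.mem_evalList_append v).1 h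
    obtain ⟨w, hΓ, h⟩ := (A.mem_evalList_append v).1 h
    obtain ⟨m, h₁, h₂⟩ := (A.mem_evalList_singleton v).1 h
    exact ih ((A.mem_evalList_append v).2 ⟨u, (A.mem_evalList_append v).2
      ⟨w, hΓ, m, h₁, u, h₂, rfl⟩, hΔ⟩)
  | prod_right _ _ ih₁ ih₂ =>
    rintro ⟨x, y⟩ h
    obtain ⟨m, h₁, h₂⟩ := (A.mem_evalList_append v).1 h
    exact ⟨m, ih₁ h₁, ih₂ h₂⟩

end RelResiduatedSemigroup

/-! ### Completeness -/

theorem exists_not_satisfies_of_not_lambekDerivable {α : Type*} {Γ : List (LambekFormula α)}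
    (hΓ : Γ ≠ []) {φ : LambekFormula α} (h : ¬LambekDerivable Γ φ) :
    ∃ (W : Type) (_ : Finite W) (A : RelResiduatedSemigroup W) (v : α → A.carrier),
      ¬A.Satisfies v Γ φ := by
  -- Indexing by positions in a list gives a finite index type in `Type`, whatever the universe of
  -- `α`, and hence a base in `Type`.
  let l : List (LambekFormula α) := (φ :: Γ).flatMap LambekFormula.subformulas
  have hmem {a : LambekFormula α} :
      a ∈ Set.range l.get ↔ ∃ b ∈ φ :: Γ, a ∈ b.subformulas := by
    rw [Set.range_list_get]
    exact List.mem_flatMap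
  have hS : ∀ a ∈ Set.range l.get, ∀ b ∈ a.subformulas, b ∈ Set.range l.get := by
    intro a ha b hb
    obtain ⟨c, hc, hac⟩ := hmem.1 ha
    exact hmem.2 ⟨c, hc, LambekFormula.mem_subformulas_trans hb hac⟩
  have hf (a b : LambekFormula α) (hab : a.prod b ∈ Set.range l.get) :
      a ∈ Set.range l.get ∧ b ∈ Set.range l.get :=
    ⟨hS _ hab _ (by simp [LambekFormula.subformulas, a.mem_subformulas_self]),
      hS _ hab _ (by simp [LambekFormula.subformulas, b.mem_subformulas_self])⟩
  have hself {a : LambekFormula α} (ha : a ∈ φ :: Γ) : a ∈ Set.range l.get :=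
    hmem.2 ⟨a, ha, a.mem_subformulas_self⟩
  -- The path spelling `Γ` ends at depth `Γ.length`, where the sequent just fails to be large.
  let N := Γ.length + antecedentSize Γ + φ.size
  let F := StageFrame.stage N l.get N
  have := F.finite
  obtain ⟨y, hle, hd, hy, hw⟩ := F.exists_mem_evalList hf hS Γ
    (fun a ha => hself (List.mem_cons_of_mem _ ha)) F.root
    (by rw [F.depth_root]; simp only [N]; omega)
  rw [F.depth_root, zero_add] at hd
  have hw' : F.word F.root y = Γ := by
    rw [hw F.root (F.refl _), F.word_self, List.nil_append]
  refine ⟨F.Point × Bool, inferInstance, (F.double hf).algebra F.doubleRel_serial,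
    (F.double hf).valuation F.doubleRel_serial, fun hsat => ?_⟩
  have hlt : F.Lt F.root y := by
    refine ⟨hle, fun h => hΓ ?_⟩
    rw [← hw', ← h, F.word_self]
  have hD : DerivableOrLarge N (max (F.depth F.root) (F.depth y)) (F.word F.root y) φ :=
    ((F.double hf).mem_eval_and_derivableOrLarge F.doubleRel_serial hS φ
      (hself List.mem_cons_self) (F.root, false) (y, false) hlt).2 (hsat hy)
  rw [hw', hd, F.depth_root] at hD
  rcases hD with hD | hD
  · exact h hD
  · simp only [N] at hD
    omega

theorem mainTheorem2 {α : Type*} (Γ : List (LambekFormula α)) (hΓ : Γ ≠ [])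
    (φ : LambekFormula α) :
    LambekDerivable Γ φ ↔
      ∀ (W : Type) [Finite W] (A : RelResiduatedSemigroup W) (v : α → A.carrier),
        A.Satisfies v Γ φ := by
  refine ⟨fun h W _ A v => A.satisfies_of_lambekDerivable v h, fun h => ?_⟩
  by_contra hn
  obtain ⟨W, _, A, v, hA⟩ := exists_not_satisfies_of_not_lambekDerivable hΓ hn
  exact hA (h W A v)
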